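/- Let $G=(V,E)$ be a finite simple graph that is two-colorable with parts $P_1,P_2$ (so $V=P_1\sqcup P_2$ and no edge joins two vertices of the same part), and let $|G\rangle=\prod_{uv\in E}CZ_{uv}\,|+\rangle^{\otimes V}$ be its graph state, with one qubit per network node $v\in V$. For $v\in P_i$ let $\overline N(v)=\{w\in V\setminus P_i : vw\notin E\}$ be its opposite remote set, and call $v\in P_i$ a star vertex if its neighborhood is all of $V\setminus P_i$. Let $V_i$ be the set of non-star vertices of $P_i$. Assume that each of $P_1$ and $P_2$ contains at least one star vertex. Let $n\ge 1$, let $i\in\{1,2\}$, and let $A_g\subseteq V_i$ be such that $|\overline N(v)|\ge n-1$ for all $v\in A_g$ and $\overline N(v)\cap\overline N(w)=\emptyset$ for all distinct $v,w\in A_g$. Then $|A_g|$ $n$-qubit GHZ states can be extracted concurrently from $|G\rangle$ among remote nodes by single-qubit Clifford gates, single-qubit Pauli measurements and classical communication. That is, there are $|A_g|$ pairwise disjoint sets of $n$ nodes each, the nodes within each set being pairwise non-adjacent in $G$, and a finite protocol of single-qubit Clifford gates and single-qubit Pauli measurements, in which each step may depend on earlier measurement outcomes, that for every sequence of outcomes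 of nonzero probability transforms $|G\rangle$, up to a nonzero scalar, into the tensor product of the GHZ states $(|0\cdots0\rangle+|1\cdots1\rangle)/\sqrt2$ on these sets and some state of the remaining qubits. In particular, for $n=2$, $|A_g|$ EPR pairs can be extracted concurrently among remote nodes. -/

import Mathlib

namespace RemoteExtraction

/-! ### Two-colorable graphs -/

section Graphs

variable {V : Type*} [Fintype V] [DecidableEq V] (G : SimpleGraph V) [DecidableRel G.Adj]

/-- The part `P_i` of the two-colorable graph `G = (P_0, P_1, E)`. -/
def part (C : G.Coloring (Fin 2)) (i : Fin 2) : Finset V :=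
  {v | C v = i}

/-- The opposite remote set of `v`: the vertices of the other part not adjacent to `v`. -/
def oppositeRemoteSet (C : G.Coloring (Fin 2)) (v : V) : Finset V :=
  {w | C w ≠ C v ∧ ¬ G.Adj v w}

/-- The set `S_i` of star vertices of `P_i`: the vertices of `P_i` whose neighborhood is
`V \ P_i`. -/
def starVertices (C : G.Coloring (Fin 2)) (i : Fin 2) : Finset V :=
  {v ∈ part G C i | G.neighborFinset v = Finset.univ \ part G C i}

/-- The set `V_i` of non-star vertices of `P_i`. -/
def nonStarVertices (C : G.Coloring (Fin 2)) (i : Fin 2) : Finset V :=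
  part G C i \ starVertices G C i

end Graphs

/-! ### Pure states of qubits -/

/-- A (not necessarily normalized) pure state of the qubits indexed by `W`, given by its
amplitudes in the computational basis. -/
abbrev State (W : Type*) := (W → Fin 2) → ℂ

/-- The graph state `∏_{uv ∈ E} CZ_{uv} |+⟩^{⊗ V}`: each edge with both ends in state `1`
contributes a sign. -/
noncomputable def graphState {V : Type*} [Fintype V] [DecidableEq V] (G : SimpleGraph V)
    [DecidableRel G.Adj] : State V :=
  fun x => (((Real.sqrt 2 : ℝ) : ℂ)⁻¹) ^ Fintype.card V *
    ∏ e ∈ G.edgeFinset, (if ∀ v ∈ e, x v = 1 then (-1 : ℂ) else 1)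

/-- The GHZ state `(|0…0⟩ + |1…1⟩) / √2` on the qubits indexed by `W`. -/
noncomputable def ghz (W : Type*) [Fintype W] : State W :=
  fun x => (((Real.sqrt 2 : ℝ) : ℂ)⁻¹) *
    ((if x = (fun _ => 0) then 1 else 0) + (if x = (fun _ => 1) then 1 else 0))

/-! ### Single-qubit Cliffords and Pauli measurements -/

/-- The three Pauli observables. -/
inductive Pauli
  | X
  | Y
  | Z

/-- The Pauli matrices. -/
noncomputable def Pauli.toMatrix : Pauli → Matrix (Fin 2) (Fin 2) ℂ
  | .X => !![0, 1; 1, 0]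
  | .Y => !![0, -Complex.I; Complex.I, 0]
  | .Z => !![1, 0; 0, -1]

/-- The projector onto the `(-1)^m`-eigenspace of a Pauli observable. -/
noncomputable def Pauli.proj (P : Pauli) (m : Fin 2) : Matrix (Fin 2) (Fin 2) ℂ :=
  (1 / 2 : ℂ) • (1 + ((-1 : ℂ) ^ (m : ℕ)) • P.toMatrix)

/-- Single-qubit Clifford gates: unitaries that map each Pauli matrix, by conjugation, to plus or
minus a Pauli matrix. -/
def IsClifford (U : Matrix (Fin 2) (Fin 2) ℂ) : Prop :=
  U ∈ Matrix.unitaryGroup (Fin 2) ℂ ∧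
    ∀ P : Pauli, ∃ Q : Pauli, U * P.toMatrix * U.conjTranspose = Q.toMatrix ∨
      U * P.toMatrix * U.conjTranspose = -Q.toMatrix

/-- Apply the matrix `M` to the qubit `v`, and the identity to all others. -/
noncomputable def applyAt {V : Type*} [DecidableEq V] (v : V) (M : Matrix (Fin 2) (Fin 2) ℂ)
    (ψ : State V) : State V :=
  fun x => ∑ b : Fin 2, M (x v) b * ψ (Function.update x v b)

/-! ### Protocols: LC + LPM + CC -/

/-- A finite protocol of single-qubit Clifford gates and single-qubit Pauli measurements.  By
classical communication, what is done after a measurement may depend on its outcome. -/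
inductive Protocol (V : Type*)
  | done : Protocol V
  | clifford (v : V) (U : Matrix (Fin 2) (Fin 2) ℂ) (hU : IsClifford U) (next : Protocol V) :
      Protocol V
  | measure (v : V) (P : Pauli) (next : Fin 2 → Protocol V) : Protocol V

/-- `p.Ensures T ψ`: started in `ψ`, the protocol ends in a state with the property `T` whatever
the measurement outcomes are.  Post-measurement states are not renormalized, and an outcome has
nonzero probability exactly when the projected state is nonzero. -/
def Protocol.Ensures {V : Type*} [DecidableEq V] (T : State V → Prop) :
    Protocol V → State V → Prop
  | .done, ψ => T ψ
  | .clifford v U _ next, ψ => next.Ensures T (applyAt v U ψ)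
  | .measure v P next, ψ =>
      ∀ m : Fin 2, applyAt v (P.proj m) ψ ≠ 0 → (next m).Ensures T (applyAt v (P.proj m) ψ)

/-- Up to normalization, `ψ` is the tensor product of one GHZ state on each `Q k` and of some
state of the remaining qubits. -/
def IsGHZProduct {V : Type*} [Fintype V] [DecidableEq V] {r : ℕ} (Q : Fin r → Finset V)
    (ψ : State V) : Prop :=
  ∃ junk : State {v : V // ∀ k, v ∉ Q k}, junk ≠ 0 ∧
    ∀ x : V → Fin 2,
      ψ x = (∏ k : Fin r, ghz {v : V // v ∈ Q k} (fun v => x v)) * junk (fun v => x v)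

/-- `r` GHZ states of `n` qubits each can be extracted concurrently from the graph state of `G` by
LC + LPM + CC, on disjoint sets of qubits fixed in advance, the nodes of each GHZ state being
pairwise remote (non-adjacent in `G`). -/
def RemoteGHZExtractable {V : Type*} [Fintype V] [DecidableEq V] (G : SimpleGraph V)
    [DecidableRel G.Adj] (r n : ℕ) : Prop :=
  ∃ Q : Fin r → Finset V,
    (∀ k, (Q k).card = n) ∧
    (∀ k l, k ≠ l → Disjoint (Q k) (Q l)) ∧
    (∀ k, ∀ u ∈ Q k, ∀ w ∈ Q k, u ≠ w → ¬ G.Adj u w) ∧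
    ∃ p : Protocol V, p.Ensures (IsGHZProduct Q) (graphState G)

end RemoteExtraction

/-!
The idea is that the two star vertices act as a switch between the bipartite graph and its
bipartite complement.  Let `P ∋ s` and `R ∋ t` be the two parts with their star vertices, written
below without `s` and `t`.  Up to normalization, the amplitude of the graph state at `x` is the
sign with exponent

`x_s (x_t + ∑_R x_r) + x_t ∑_P x_p + ∑_{p ∈ P} ∑_{r ∈ R} adj(p, r) x_p x_r`  (mod 2),

by `graphState_eq_of_star`.  Measuring `X` on `s` with outcome `m` imposes `x_t = m + ∑_R x_r`
(`applyAt_proj_X_sgn`), and measuring `X` on `t` with outcome `m'` then replaces the terms in `x_s`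
and `x_t` by `(m + ∑_R x_r) (m' + ∑_P x_p)` (`applyAt_proj_X_constraint`).  Up to linear terms this
adds `1` to every entry of `adj`, so that exactly the pairs of *remote* vertices of opposite parts
are now joined.

Choose for each `a ∈ A` a set `B a` of `n - 1` opposite remote vertices.  Since the opposite remote
sets are disjoint, the complemented graph restricted to `A` and the sets `B a` is a disjoint union
of stars with centers `a` and leaf sets `B a`.  All other vertices are deleted by `Z` measurements,
which only create linear terms (`exists_star_forest_form`).  Linear terms are removed by `Z` gates
chosen according to the outcomes, and Hadamard gates on the leaves turn each sign
`(-1)^(x_b x_a)` into the constraint `x_b = x_a` (`applyList_hadamard`), that is, each star into a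
GHZ state (`isGHZProduct_of_leaves`).  The set of `n` qubits belonging to `a` is `{a} ∪ B a`, which
is independent in the graph.

The `Z` measurements commute with the rest and are carried out before the two `X` measurements.
-/

namespace RemoteExtraction

open scoped Fin.CommRing

/-! ### Signs -/

/-- The nontrivial character of `ℤ/2ℤ`, written on `Fin 2` because the amplitudes are indexed by
`Fin 2`-valued assignments. -/
noncomputable def sgn (a : Fin 2) : ℂ := (-1) ^ (a : ℕ)

@[simp] lemma sgn_zero : sgn 0 = 1 := by simp [sgn]

@[simp] lemma sgn_one : sgn 1 = -1 := by simp [sgn]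

lemma sgn_add (a b : Fin 2) : sgn (a + b) = sgn a * sgn b := by
  fin_cases a <;> fin_cases b <;> simp [sgn]

lemma sgn_sum {ι : Type*} (S : Finset ι) (f : ι → Fin 2) :
    sgn (∑ k ∈ S, f k) = ∏ k ∈ S, sgn (f k) := by
  classical
  induction S using Finset.induction_on with
  | empty => simp
  | insert a S ha ih => rw [Finset.sum_insert ha, Finset.prod_insert ha, sgn_add, ih]

lemma sgn_mul_self (a : Fin 2) : sgn a * sgn a = 1 := by
  fin_cases a <;> simp

lemma sgn_ne_zero (a : Fin 2) : sgn a ≠ 0 := by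
  fin_cases a <;> simp

/-! ### Clifford gates -/

/-- The Hadamard gate. -/
noncomputable def hadamard : Matrix (Fin 2) (Fin 2) ℂ :=
  ((Real.sqrt 2 : ℝ) : ℂ)⁻¹ • !![1, 1; 1, -1]

/-- The power `Z ^ a` of the Pauli matrix `Z`. -/
noncomputable def zPow (a : Fin 2) : Matrix (Fin 2) (Fin 2) ℂ :=
  !![1, 0; 0, sgn a]

lemma sqrt_two_mul_self : ((Real.sqrt 2 : ℝ) : ℂ) * ((Real.sqrt 2 : ℝ) : ℂ) = 2 := by
  rw [← Complex.ofReal_mul, Real.mul_self_sqrt (by norm_num)]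
  norm_num

lemma sqrt_two_ne_zero : ((Real.sqrt 2 : ℝ) : ℂ) ≠ 0 := by
  intro h
  have := sqrt_two_mul_self
  rw [h] at this
  norm_num at this

lemma inv_sqrt_two_mul_self :
    ((Real.sqrt 2 : ℝ) : ℂ)⁻¹ * ((Real.sqrt 2 : ℝ) : ℂ)⁻¹ = 1 / 2 := by
  rw [← mul_inv, sqrt_two_mul_self]
  norm_num

lemma conjTranspose_hadamard : hadamard.conjTranspose = hadamard := by
  ext i j
  fin_cases i <;> fin_cases j <;> simp [hadamard]

lemma hadamard_conj (M : Matrix (Fin 2) (Fin 2) ℂ) :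
    hadamard * M * hadamard.conjTranspose =
      (1 / 2 : ℂ) • (!![1, 1; 1, -1] * M * !![1, 1; 1, -1]) := by
  rw [conjTranspose_hadamard, hadamard, Matrix.smul_mul, Matrix.smul_mul, Matrix.mul_smul,
    smul_smul, inv_sqrt_two_mul_self]

lemma isClifford_hadamard : IsClifford hadamard := by
  refine ⟨?_, fun P => ?_⟩
  · rw [Matrix.mem_unitaryGroup_iff, Matrix.star_eq_conjTranspose]
    have h := hadamard_conj 1
    rw [Matrix.mul_one] at h
    rw [h]
    ext i j
    fin_cases i <;> fin_cases j <;> norm_num [Matrix.mul_apply, Fin.sum_univ_two]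
  · rw [hadamard_conj]
    cases P
    · refine ⟨.Z, .inl ?_⟩
      ext i j
      fin_cases i <;> fin_cases j <;>
        norm_num [Pauli.toMatrix, Matrix.mul_apply, Fin.sum_univ_two]
    · refine ⟨.Y, .inr ?_⟩
      ext i j
      fin_cases i <;> fin_cases j <;>
        norm_num [Pauli.toMatrix, Matrix.mul_apply, Fin.sum_univ_two] <;> ring
    · refine ⟨.X, .inl ?_⟩
      ext i j
      fin_cases i <;> fin_cases j <;>
        norm_num [Pauli.toMatrix, Matrix.mul_apply, Fin.sum_univ_two]

lemma isClifford_zPow (a : Fin 2) : IsClifford (zPow a) := by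
  refine ⟨?_, fun P => ⟨P, ?_⟩⟩
  · rw [Matrix.mem_unitaryGroup_iff, Matrix.star_eq_conjTranspose]
    ext i j
    fin_cases a <;> fin_cases i <;> fin_cases j <;>
      simp [zPow, Matrix.mul_apply, Fin.sum_univ_two]
  · fin_cases a
    · left
      ext i j
      cases P <;> fin_cases i <;> fin_cases j <;>
        simp [zPow, Pauli.toMatrix, Matrix.mul_apply, Fin.sum_univ_two]
    · cases P
      · right
        ext i j
        fin_cases i <;> fin_cases j <;>
          simp [zPow, Pauli.toMatrix, Matrix.mul_apply, Fin.sum_univ_two]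
      · right
        ext i j
        fin_cases i <;> fin_cases j <;>
          simp [zPow, Pauli.toMatrix, Matrix.mul_apply, Fin.sum_univ_two]
      · left
        ext i j
        fin_cases i <;> fin_cases j <;>
          simp [zPow, Pauli.toMatrix, Matrix.mul_apply, Fin.sum_univ_two]

/-! ### Action of gates and measurements on amplitudes -/

section Amplitudes

variable {V : Type*} [DecidableEq V]

lemma applyAt_zPow (v : V) (a : Fin 2) (ψ : State V) :
    applyAt v (zPow a) ψ = fun x => sgn (a * x v) * ψ x := by
  funext x
  have hx : ψ x = ψ (Function.update x v (x v)) := by rw [Function.update_eq_self]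
  rw [hx, applyAt, Fin.sum_univ_two]
  generalize x v = c
  fin_cases c <;> simp [zPow]

lemma applyAt_proj_Z (v : V) (m : Fin 2) (ψ : State V) :
    applyAt v (Pauli.Z.proj m) ψ = fun x => (if x v = m then 1 else 0) * ψ x := by
  funext x
  have hx : ψ x = ψ (Function.update x v (x v)) := by rw [Function.update_eq_self]
  rw [hx, applyAt, Fin.sum_univ_two]
  generalize x v = c
  fin_cases c <;> fin_cases m <;> norm_num [Pauli.proj, Pauli.toMatrix]

lemma proj_X_apply (m a b : Fin 2) : Pauli.X.proj m a b = 1 / 2 * sgn (m * (a + b)) := by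
  fin_cases m <;> fin_cases a <;> fin_cases b <;> norm_num [Pauli.proj, Pauli.toMatrix, sgn]

lemma hadamard_apply (a b : Fin 2) :
    hadamard a b = ((Real.sqrt 2 : ℝ) : ℂ)⁻¹ * sgn (a * b) := by
  fin_cases a <;> fin_cases b <;> simp [hadamard]

lemma sum_sgn_mul (a c : Fin 2) :
    ∑ b : Fin 2, sgn (a * b) * sgn (b * c) = 2 * if a = c then 1 else 0 := by
  rw [Fin.sum_univ_two]
  fin_cases a <;> fin_cases c <;> norm_num

/-- An `X` measurement of a qubit whose value enters the sign linearly, with coefficient `L`,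
imposes the parity constraint `L = m` on the remaining qubits. -/
lemma applyAt_proj_X_sgn (s : V) (m : Fin 2) (F : State V) (L : (V → Fin 2) → Fin 2)
    (hF : ∀ x b, F (Function.update x s b) = F x)
    (hL : ∀ x b, L (Function.update x s b) = L x) :
    applyAt s (Pauli.X.proj m) (fun x => F x * sgn (x s * L x)) =
      fun x => F x * (sgn (m * x s) * if L x = m then 1 else 0) := by
  funext x
  have key : ∀ a c : Fin 2, ∑ b : Fin 2, 1 / 2 * sgn (m * (a + b)) * sgn (b * c) =
      sgn (m * a) * if c = m then 1 else 0 := by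
    intro a c
    simp only [mul_add, sgn_add]
    have h := sum_sgn_mul m c
    rw [Fin.sum_univ_two] at h ⊢
    simp only [eq_comm (a := c)]
    linear_combination (1 / 2 * sgn (m * a)) * h
  simp only [applyAt, hF, hL, Function.update_self, proj_X_apply]
  rw [← key, Finset.mul_sum]
  refine Finset.sum_congr rfl fun b _ => by ring

/-- An `X` measurement of a qubit that carries a parity constraint and enters the sign linearly:
the constraint determines its value, which is substituted into the sign. -/
lemma applyAt_proj_X_constraint (t : V) (m m' : Fin 2) (F : State V)
    (L M : (V → Fin 2) → Fin 2)
    (hF : ∀ x b, F (Function.update x t b) = F x)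
    (hL : ∀ x b, L (Function.update x t b) = L x)
    (hM : ∀ x b, M (Function.update x t b) = M x) :
    applyAt t (Pauli.X.proj m')
        (fun x => F x * (sgn (x t * M x) * if x t + L x = m then 1 else 0)) =
      fun x => F x * (1 / 2 * sgn (m' * x t) * sgn ((m + L x) * (m' + M x))) := by
  funext x
  have key : ∀ a l c : Fin 2,
      ∑ b : Fin 2, sgn (m' * (a + b)) * (sgn (b * c) * if b + l = m then 1 else 0) =
      sgn (m' * a) * sgn ((m + l) * (m' + c)) := by
    intro a l c
    simp only [mul_add, sgn_add, Fin.sum_univ_two]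
    generalize sgn (m' * a) = w
    fin_cases m <;> fin_cases l <;> fin_cases m' <;> fin_cases c <;> simp [sgn]
  simp only [applyAt, hF, hL, hM, Function.update_self, proj_X_apply]
  rw [mul_assoc (1 / 2 : ℂ), ← key, Finset.mul_sum, Finset.mul_sum]
  refine Finset.sum_congr rfl fun b _ => by ring

/-- A Hadamard gate turns a controlled sign into an equality of two qubits. -/
lemma applyAt_hadamard_sgn (v : V) (F : State V) (L : (V → Fin 2) → Fin 2)
    (hF : ∀ x b, F (Function.update x v b) = F x)
    (hL : ∀ x b, L (Function.update x v b) = L x) :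
    applyAt v hadamard (fun x => F x * sgn (x v * L x)) =
      fun x => F x * (((Real.sqrt 2 : ℝ) : ℂ) * if x v = L x then 1 else 0) := by
  funext x
  have h := sum_sgn_mul (x v) (L x)
  have h2 : ((Real.sqrt 2 : ℝ) : ℂ)⁻¹ * 2 = ((Real.sqrt 2 : ℝ) : ℂ) := by
    rw [← sqrt_two_mul_self, inv_mul_cancel_left₀ sqrt_two_ne_zero]
  have h3 : ((Real.sqrt 2 : ℝ) : ℂ) * (if x v = L x then 1 else 0) =
      ((Real.sqrt 2 : ℝ) : ℂ)⁻¹ * ∑ b : Fin 2, sgn (x v * b) * sgn (b * L x) := by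
    rw [h, ← mul_assoc, h2]
  simp only [applyAt, hF, hL, Function.update_self, hadamard_apply]
  rw [h3, Finset.mul_sum, Finset.mul_sum]
  refine Finset.sum_congr rfl fun b _ => by ring

/-! ### Compound protocols -/

/-- Measure `Z` on the qubits of a list, then continue depending on the recorded outcomes; the
outcome recorded for a qubit that is not in the list is `0`. -/
def Protocol.measureZ : List V → ((V → Fin 2) → Protocol V) → Protocol V
  | [], k => k 0
  | v :: l, k => .measure v .Z fun m => measureZ l fun z => k (Function.update z v m)

lemma Protocol.ensures_measureZ (T : State V → Prop) (l : List V) (hl : l.Nodup)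
    (k : (V → Fin 2) → Protocol V) (ψ : State V)
    (h : ∀ z, (k z).Ensures T fun x =>
      (l.map fun v => if x v = z v then 1 else 0).prod * ψ x) :
    (Protocol.measureZ l k).Ensures T ψ := by
  induction l generalizing k ψ with
  | nil => simpa [Protocol.measureZ] using h 0
  | cons v l ih =>
    obtain ⟨hv, hl⟩ := List.nodup_cons.1 hl
    intro m _
    rw [applyAt_proj_Z]
    refine ih hl _ _ fun z => ?_
    convert h (Function.update z v m) using 1
    funext x
    rw [List.map_cons, List.prod_cons, Function.update_self, ← mul_assoc,
      mul_comm (List.prod _)]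
    congr 3
    exact List.map_congr_left fun w hw => by
      rw [Function.update_of_ne (ne_of_mem_of_not_mem hw hv)]

/-- Apply the Clifford gate `U v` to each qubit `v` of a list. -/
def Protocol.cliffords (U : V → Matrix (Fin 2) (Fin 2) ℂ) (hU : ∀ v, IsClifford (U v)) :
    List V → Protocol V → Protocol V
  | [], p => p
  | v :: l, p => .clifford v (U v) (hU v) (cliffords U hU l p)

/-- The matrices `U v` applied in turn to the qubits `v` of a list. -/
noncomputable def applyList (U : V → Matrix (Fin 2) (Fin 2) ℂ) : List V → State V → State V
  | [], ψ => ψ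
  | v :: l, ψ => applyList U l (applyAt v (U v) ψ)

lemma Protocol.ensures_cliffords (T : State V → Prop) (U : V → Matrix (Fin 2) (Fin 2) ℂ)
    (hU : ∀ v, IsClifford (U v)) (l : List V) (p : Protocol V) (ψ : State V) :
    (Protocol.cliffords U hU l p).Ensures T ψ ↔ p.Ensures T (applyList U l ψ) := by
  induction l generalizing ψ with
  | nil => rfl
  | cons v l ih => exact ih _

lemma applyList_zPow (g : V → Fin 2) (l : List V) (ψ : State V) :
    applyList (fun v => zPow (g v)) l ψ =
      fun x => (l.map fun v => sgn (g v * x v)).prod * ψ x := by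
  induction l generalizing ψ with
  | nil => simp [applyList]
  | cons v l ih =>
    rw [applyList, applyAt_zPow, ih]
    funext x
    simp only [List.map_cons, List.prod_cons]
    ring

/-- Hadamard gates on the leaves of a disjoint union of star graphs, `α b` being the center of
the star of the leaf `b`, turn each controlled sign into an equality. -/
lemma applyList_hadamard (α : V → V) (l : List V) (hl : l.Nodup) (hα : ∀ b ∈ l, α b ∉ l)
    (F : State V) (hF : ∀ v ∈ l, ∀ x b, F (Function.update x v b) = F x) :
    applyList (fun _ => hadamard) l
        (fun x => F x * (l.map fun v => sgn (x v * x (α v))).prod) =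
      fun x => F x *
        (l.map fun v => ((Real.sqrt 2 : ℝ) : ℂ) * if x v = x (α v) then 1 else 0).prod := by
  induction l generalizing F with
  | nil => simp [applyList]
  | cons v l ih =>
    obtain ⟨hv, hl⟩ := List.nodup_cons.1 hl
    have hαv := hα v List.mem_cons_self
    rw [List.mem_cons, not_or] at hαv
    have hαl : ∀ w ∈ l, α w ≠ v ∧ α w ∉ l := fun w hw => by
      have := hα w (List.mem_cons_of_mem _ hw)
      rwa [List.mem_cons, not_or] at this
    have h := applyAt_hadamard_sgn v
      (fun x => F x * (l.map fun w => sgn (x w * x (α w))).prod) (fun x => x (α v))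
      (fun x b => by
        rw [hF v List.mem_cons_self]
        congr 2
        refine List.map_congr_left fun w hw => ?_
        rw [Function.update_of_ne (ne_of_mem_of_not_mem hw hv), Function.update_of_ne (hαl w hw).1])
      (fun x b => Function.update_of_ne hαv.1 _ _)
    rw [applyList]
    have e1 : (fun x : V → Fin 2 =>
          F x * ((v :: l).map fun w => sgn (x w * x (α w))).prod) =
        fun x => F x * (l.map fun w => sgn (x w * x (α w))).prod * sgn (x v * x (α v)) := by
      funext x
      simp only [List.map_cons, List.prod_cons]
      ring
    have e2 : (fun x : V → Fin 2 => F x * (l.map fun w => sgn (x w * x (α w))).prod *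
          (((Real.sqrt 2 : ℝ) : ℂ) * if x v = x (α v) then 1 else 0)) =
        fun x => (F x * (((Real.sqrt 2 : ℝ) : ℂ) * if x v = x (α v) then 1 else 0)) *
          (l.map fun w => sgn (x w * x (α w))).prod := by
      funext x
      ring
    rw [e1, h, e2, ih hl (fun w hw => (hαl w hw).2)]
    · funext x
      simp only [List.map_cons, List.prod_cons]
      ring
    · intro w hw x b
      rw [hF w (List.mem_cons_of_mem _ hw),
        Function.update_of_ne (ne_of_mem_of_not_mem hw hv).symm,
        Function.update_of_ne (ne_of_mem_of_not_mem hw hαv.2).symm]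

end Amplitudes

/-! ### The sign of a two-colorable graph state -/

section GraphStates

variable {V : Type*} [Fintype V] (G : SimpleGraph V) [DecidableRel G.Adj]

lemma prod_edgeFinset_of_coloring (C : G.Coloring (Fin 2)) (i : Fin 2) (f : Sym2 V → ℂ) :
    ∏ e ∈ G.edgeFinset, f e =
      ∏ p with C p = i, ∏ r with C r ≠ i, if G.Adj p r then f s(p, r) else 1 := by
  rw [← Finset.prod_product', ← Finset.prod_filter]
  symm
  refine Finset.prod_nbij (fun pr => s(pr.1, pr.2)) ?_ ?_ ?_ fun _ _ => rfl
  · rintro ⟨p, r⟩ h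
    simpa using (Finset.mem_filter.1 h).2
  · rintro ⟨p, r⟩ h ⟨p', r'⟩ h' e
    simp only [Finset.coe_filter, Finset.mem_product, Finset.mem_filter, Finset.mem_univ,
      true_and, Set.mem_ofPred_eq] at h h'
    rcases Sym2.eq_iff.1 e with ⟨rfl, rfl⟩ | ⟨rfl, rfl⟩
    · rfl
    · exact absurd h.1.1 h'.1.2
  · intro e he
    induction e using Sym2.ind with
    | _ u v =>
      have huv : G.Adj u v := by simpa using he
      have hC := C.valid huv
      by_cases hu : C u = i
      · exact ⟨(u, v), by simpa [huv, hu] using fun h : C v = i => hC (hu.trans h.symm), rfl⟩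
      · have hv : C v = i := by omega
        exact ⟨(v, u), by simp [huv.symm, hu, hv], Sym2.eq_swap⟩

/-- The amplitudes of the graph state when `s` and `t` are star vertices of the two parts: the
qubits of `s` and `t` enter the exponent of the sign through the parities of the opposite parts. -/
lemma graphState_eq_of_star [DecidableEq V] (C : G.Coloring (Fin 2)) (i : Fin 2) (s t : V)
    (hs : C s = i) (ht : C t ≠ i) (hsadj : ∀ r, C r ≠ i → G.Adj s r)
    (htadj : ∀ p, C p = i → G.Adj p t) (x : V → Fin 2) :
    graphState G x = (((Real.sqrt 2 : ℝ) : ℂ)⁻¹) ^ Fintype.card V *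
      sgn ((∑ p ∈ ({p | C p = i} : Finset V).erase s, ∑ r ∈ ({r | C r ≠ i} : Finset V).erase t,
          (if G.Adj p r then 1 else 0) * (x p * x r)) +
        x t * (∑ p ∈ ({p | C p = i} : Finset V).erase s, x p) +
        x s * (x t + ∑ r ∈ ({r | C r ≠ i} : Finset V).erase t, x r)) := by
  have hq : (∑ p with C p = i, ∑ r with C r ≠ i, (if G.Adj p r then 1 else 0) * (x p * x r)) =
      ((∑ p ∈ ({p | C p = i} : Finset V).erase s, ∑ r ∈ ({r | C r ≠ i} : Finset V).erase t,
          (if G.Adj p r then 1 else 0) * (x p * x r)) +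
        x t * (∑ p ∈ ({p | C p = i} : Finset V).erase s, x p) +
        x s * (x t + ∑ r ∈ ({r | C r ≠ i} : Finset V).erase t, x r)) := by
    have hin : ∀ p, C p = i →
        (∑ r with C r ≠ i, (if G.Adj p r then 1 else 0) * (x p * x r)) =
        x p * x t + ∑ r ∈ ({r | C r ≠ i} : Finset V).erase t,
          (if G.Adj p r then 1 else 0) * (x p * x r) := fun p hp => by
      rw [← Finset.add_sum_erase _ _ (by simpa using ht : t ∈ ({r | C r ≠ i} : Finset V)),
        if_pos (htadj p hp), one_mul]
    have hS : (∑ r ∈ ({r | C r ≠ i} : Finset V).erase t,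
          (if G.Adj s r then 1 else 0) * (x s * x r)) =
        x s * ∑ r ∈ ({r | C r ≠ i} : Finset V).erase t, x r := by
      rw [Finset.mul_sum]
      refine Finset.sum_congr rfl fun r hr => ?_
      rw [if_pos (hsadj r (Finset.mem_filter.1 (Finset.mem_of_mem_erase hr)).2), one_mul]
    have hP : ∀ p ∈ ({p | C p = i} : Finset V).erase s, C p = i := fun p hp =>
      (Finset.mem_filter.1 (Finset.mem_of_mem_erase hp)).2
    rw [← Finset.add_sum_erase _ _ (by simpa using hs : s ∈ ({p | C p = i} : Finset V)),
      hin s hs, hS, Finset.sum_congr rfl fun p hp => hin p (hP p hp), Finset.sum_add_distrib,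
      ← Finset.sum_mul]
    ring
  rw [← hq, graphState, prod_edgeFinset_of_coloring G C i, sgn_sum]
  congr 1
  refine Finset.prod_congr rfl fun p _ => ?_
  rw [sgn_sum]
  refine Finset.prod_congr rfl fun r _ => ?_
  by_cases h : G.Adj p r
  · simp only [h, if_true, one_mul, Sym2.mem_iff, forall_eq_or_imp, forall_eq]
    generalize x p = a
    generalize x r = b
    fin_cases a <;> fin_cases b <;> simp
  · simp [h]

end GraphStates

/-- The sign exponent after the star vertices have been measured in `X`.  The product of the two
parities complements the bipartite graph between `P` and `R`; once the qubits outside `A ∪ B` are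
fixed, what remains is a quadratic form with an edge from each `b ∈ B` to `α b` only, up to linear
terms. -/
lemma exists_star_forest_form {V : Type*} [DecidableEq V] (P R A B : Finset V)
    (hPR : Disjoint P R) (hA : A ⊆ P) (hB : B ⊆ R) (α : V → V) (hα : ∀ b ∈ B, α b ∈ A)
    (adj : V → V → Fin 2)
    (hadj : ∀ a ∈ A, ∀ b ∈ B, adj a b + 1 = if a = α b then 1 else 0)
    (z : V → Fin 2) (m m' : Fin 2) :
    ∃ (κ : Fin 2) (g : V → Fin 2), ∀ x : V → Fin 2,
      (∀ v ∈ P \ A, x v = z v) → (∀ v ∈ R \ B, x v = z v) →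
      (∑ p ∈ P, ∑ r ∈ R, adj p r * (x p * x r)) + (m + ∑ r ∈ R, x r) * (m' + ∑ p ∈ P, x p) =
        κ + ∑ v ∈ A ∪ B, g v * x v + ∑ b ∈ B, x b * x (α b) := by
  refine ⟨m * m' + m * ∑ p ∈ P \ A, z p + m' * ∑ r ∈ R \ B, z r +
      ∑ p ∈ P \ A, ∑ r ∈ R \ B, (adj p r + 1) * (z p * z r),
    fun v => if v ∈ A then m + ∑ r ∈ R \ B, (adj v r + 1) * z r
      else m' + ∑ p ∈ P \ A, (adj p v + 1) * z p, fun x hxP hxR => ?_⟩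
  have hAB : Disjoint A B :=
    Finset.disjoint_of_subset_left hA (Finset.disjoint_of_subset_right hB hPR)
  have e1 : (∑ p ∈ P, ∑ r ∈ R, adj p r * (x p * x r)) +
        (m + ∑ r ∈ R, x r) * (m' + ∑ p ∈ P, x p) =
      m * m' + m * ∑ p ∈ P, x p + m' * ∑ r ∈ R, x r +
        ∑ p ∈ P, ∑ r ∈ R, (adj p r + 1) * (x p * x r) := by
    simp only [add_mul, one_mul, Finset.sum_add_distrib, ← Finset.sum_mul_sum, mul_add]
    ring
  have zP : ∑ p ∈ P \ A, x p = ∑ p ∈ P \ A, z p := Finset.sum_congr rfl hxP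
  have zR : ∑ r ∈ R \ B, x r = ∑ r ∈ R \ B, z r := Finset.sum_congr rfl hxR
  have sP : ∑ p ∈ P, x p = ∑ p ∈ P \ A, z p + ∑ a ∈ A, x a := by
    rw [← zP, Finset.sum_sdiff hA]
  have sR : ∑ r ∈ R, x r = ∑ r ∈ R \ B, z r + ∑ b ∈ B, x b := by
    rw [← zR, Finset.sum_sdiff hB]
  have hin : ∀ p, ∑ r ∈ R, (adj p r + 1) * (x p * x r) =
      ∑ r ∈ R \ B, (adj p r + 1) * (x p * z r) + ∑ b ∈ B, (adj p b + 1) * (x p * x b) := fun p => by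
    rw [← Finset.sum_sdiff hB]
    congr 1
    exact Finset.sum_congr rfl fun r hr => by rw [hxR r hr]
  have e2 : ∑ p ∈ P, ∑ r ∈ R, (adj p r + 1) * (x p * x r) =
      ∑ p ∈ P \ A, ∑ r ∈ R \ B, (adj p r + 1) * (z p * z r) +
      ∑ b ∈ B, (∑ p ∈ P \ A, (adj p b + 1) * z p) * x b +
      ∑ a ∈ A, (∑ r ∈ R \ B, (adj a r + 1) * z r) * x a + ∑ b ∈ B, x b * x (α b) := by
    rw [← Finset.sum_sdiff hA]
    simp only [hin, Finset.sum_add_distrib]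
    have f1 : ∑ p ∈ P \ A, ∑ r ∈ R \ B, (adj p r + 1) * (x p * z r) =
        ∑ p ∈ P \ A, ∑ r ∈ R \ B, (adj p r + 1) * (z p * z r) :=
      Finset.sum_congr rfl fun p hp => by rw [hxP p hp]
    have f2 : ∑ p ∈ P \ A, ∑ b ∈ B, (adj p b + 1) * (x p * x b) =
        ∑ b ∈ B, (∑ p ∈ P \ A, (adj p b + 1) * z p) * x b := by
      rw [Finset.sum_comm]
      refine Finset.sum_congr rfl fun b _ => ?_
      rw [Finset.sum_mul]
      exact Finset.sum_congr rfl fun p hp => by rw [hxP p hp, mul_assoc]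
    have f3 : ∑ a ∈ A, ∑ r ∈ R \ B, (adj a r + 1) * (x a * z r) =
        ∑ a ∈ A, (∑ r ∈ R \ B, (adj a r + 1) * z r) * x a := by
      refine Finset.sum_congr rfl fun a _ => ?_
      rw [Finset.sum_mul]
      exact Finset.sum_congr rfl fun r _ => by ring
    have f4 : ∑ a ∈ A, ∑ b ∈ B, (adj a b + 1) * (x a * x b) = ∑ b ∈ B, x b * x (α b) := by
      rw [Finset.sum_comm]
      refine Finset.sum_congr rfl fun b hb => ?_
      rw [Finset.sum_congr rfl fun a ha => by rw [hadj a ha b hb],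
        Finset.sum_eq_single_of_mem (α b) (hα b hb) fun a _ hne => by rw [if_neg hne, zero_mul]]
      rw [if_pos rfl]
      ring
    rw [f1, f2, f3, f4]
    ring
  have e3 : ∑ v ∈ A ∪ B, (if v ∈ A then m + ∑ r ∈ R \ B, (adj v r + 1) * z r
        else m' + ∑ p ∈ P \ A, (adj p v + 1) * z p) * x v =
      m * ∑ a ∈ A, x a + ∑ a ∈ A, (∑ r ∈ R \ B, (adj a r + 1) * z r) * x a +
        (m' * ∑ b ∈ B, x b + ∑ b ∈ B, (∑ p ∈ P \ A, (adj p b + 1) * z p) * x b) := by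
    rw [Finset.sum_union hAB, Finset.mul_sum, Finset.mul_sum, ← Finset.sum_add_distrib,
      ← Finset.sum_add_distrib]
    congr 1
    · exact Finset.sum_congr rfl fun a ha => by rw [if_pos ha, add_mul]
    · exact Finset.sum_congr rfl fun b hb => by
        rw [if_neg (Finset.disjoint_right.1 hAB hb), add_mul]
  rw [e1, e2, e3, sP, sR]
  ring

/-! ### Recognizing products of GHZ states -/

/-- The instance on the subtype is arbitrary, so that the lemma applies to the one that occurs in
`IsGHZProduct`. -/
lemma ghz_insert {V : Type*} [DecidableEq V] (a : V) (B : Finset V)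
    [Fintype {v : V // v ∈ insert a B}] (x : V → Fin 2) :
    ghz {v : V // v ∈ insert a B} (fun v => x v) =
      ((Real.sqrt 2 : ℝ) : ℂ)⁻¹ * ∏ b ∈ B, if x b = x a then 1 else 0 := by
  have hc : ∀ c : Fin 2, (fun v : {v : V // v ∈ insert a B} => x v) = (fun _ => c) ↔
      x a = c ∧ ∀ b ∈ B, x b = x a := by
    intro c
    constructor
    · intro h
      have ha : x a = c := congrFun h ⟨a, Finset.mem_insert_self a B⟩
      exact ⟨ha, fun b hb => (congrFun h ⟨b, Finset.mem_insert_of_mem hb⟩).trans ha.symm⟩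
    · rintro ⟨ha, h⟩
      funext ⟨v, hv⟩
      rcases Finset.mem_insert.1 hv with rfl | hv
      · exact ha
      · exact (h v hv).trans ha
  rw [ghz, Finset.prod_ite_zero]
  simp only [hc, Finset.prod_const_one]
  congr 1
  -- If all values agree, exactly one of the two terms of the GHZ state contributes.
  by_cases h : ∀ b ∈ B, x b = x a
  · simp only [and_iff_left h, if_pos h]
    generalize x a = c
    fin_cases c <;> simp
  · simp only [h, and_false, if_false, add_zero]

/-- A state in which every leaf `b` is tied to its center `α b`, and which is otherwise a function
of the remaining qubits, is a product of GHZ states. -/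
lemma isGHZProduct_of_leaves {V : Type*} [Fintype V] [DecidableEq V] (A : Finset V)
    (B : V → Finset V) (α : V → V) (hα : ∀ a ∈ A, ∀ b ∈ B a, α b = a)
    (F : State V) (hF : ∀ x y, (∀ v ∉ A ∪ A.biUnion B, x v = y v) → F x = F y)
    (z : V → Fin 2) (hz : F z ≠ 0) (ψ : State V)
    (hψ : ∀ x, ψ x = F x *
      ∏ b ∈ A.biUnion B, (((Real.sqrt 2 : ℝ) : ℂ) * if x b = x (α b) then 1 else 0)) :
    IsGHZProduct (fun k : Fin A.card =>
      insert (A.equivFin.symm k : V) (B (A.equivFin.symm k))) ψ := by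
  set Q : Fin A.card → Finset V := fun k =>
    insert (A.equivFin.symm k : V) (B (A.equivFin.symm k)) with hQ
  have hout : ∀ v, v ∉ A ∪ A.biUnion B → ∀ k, v ∉ Q k := by
    intro v hv k hk
    apply hv
    rcases Finset.mem_insert.1 hk with h | h
    · exact Finset.mem_union_left _ (h ▸ (A.equivFin.symm k).2)
    · exact Finset.mem_union_right _ (Finset.mem_biUnion.2 ⟨_, (A.equivFin.symm k).2, h⟩)
  let ext : ({v : V // ∀ k, v ∉ Q k} → Fin 2) → V → Fin 2 := fun y v =>
    if h : ∀ k, v ∉ Q k then y ⟨v, h⟩ else 0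
  have hext : ∀ x : V → Fin 2, F (ext fun v => x v) = F x := fun x =>
    hF _ _ fun v hv => dif_pos (hout v hv)
  have hpos : ((Real.sqrt 2 : ℝ) : ℂ) ≠ 0 := sqrt_two_ne_zero
  refine ⟨fun y => ((Real.sqrt 2 : ℝ) : ℂ) ^ A.card *
    ((Real.sqrt 2 : ℝ) : ℂ) ^ (A.biUnion B).card * F (ext y), fun h0 => ?_, fun x => ?_⟩
  · have h := congrFun h0 fun v => z v
    simp only [hext, Pi.zero_apply] at h
    exact (mul_ne_zero (mul_ne_zero (pow_ne_zero _ hpos) (pow_ne_zero _ hpos)) hz) h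
  · have hdis : Set.PairwiseDisjoint (A : Set V) B := by
      intro a ha a' ha' hne
      refine Finset.disjoint_left.2 fun b hb hb' => hne ?_
      rw [← hα a ha b hb, hα a' ha' b hb']
    have h1 : ∏ k : Fin A.card, ghz {v : V // v ∈ Q k} (fun v => x v) =
        (((Real.sqrt 2 : ℝ) : ℂ)⁻¹) ^ A.card *
          ∏ b ∈ A.biUnion B, if x b = x (α b) then 1 else 0 := by
      rw [Finset.prod_congr rfl fun k _ => ghz_insert _ _ x,
        Equiv.prod_comp A.equivFin.symm (fun a : {a // a ∈ A} =>
          ((Real.sqrt 2 : ℝ) : ℂ)⁻¹ * ∏ b ∈ B a, if x b = x a then 1 else 0),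
        Finset.prod_coe_sort A (fun a =>
          ((Real.sqrt 2 : ℝ) : ℂ)⁻¹ * ∏ b ∈ B a, if x b = x a then 1 else 0),
        Finset.prod_mul_distrib, Finset.prod_const, Finset.prod_biUnion hdis]
      congr 1
      exact Finset.prod_congr rfl fun a ha => Finset.prod_congr rfl fun b hb => by
        rw [hα a ha b hb]
    simp only [hext]
    rw [h1, hψ, Finset.prod_mul_distrib, Finset.prod_const, inv_pow]
    field_simp

/-! ### Extraction -/

section Extraction

variable {V : Type*} [Fintype V] [DecidableEq V] (G : SimpleGraph V) [DecidableRel G.Adj]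

/-- The extraction protocol for stars with center set `A`, leaf sets `B a` and star vertices
`s`, `t` in the two parts: measuring `X` on `s` and `t` replaces the bipartite graph between the
parts by its complement, and measuring `Z` on the unused qubits deletes them. -/
lemma exists_protocol_of_star (C : G.Coloring (Fin 2)) (i : Fin 2) (s t : V)
    (hs : C s = i) (ht : C t ≠ i) (hsadj : ∀ r, C r ≠ i → G.Adj s r)
    (htadj : ∀ p, C p = i → G.Adj p t) (A : Finset V) (B : V → Finset V) (α : V → V)
    (hA : ∀ a ∈ A, C a = i ∧ a ≠ s) (hB : ∀ a ∈ A, ∀ b ∈ B a, C b ≠ i ∧ b ≠ t)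
    (hα : ∀ a ∈ A, ∀ b ∈ B a, α b = a)
    (hadj : ∀ a ∈ A, ∀ b ∈ A.biUnion B, G.Adj a b ↔ a ≠ α b) :
    ∃ p : Protocol V, p.Ensures (IsGHZProduct fun k : Fin A.card =>
      insert (A.equivFin.symm k : V) (B (A.equivFin.symm k))) (graphState G) := by
  set L := A.biUnion B with hL
  set P : Finset V := ({p | C p = i} : Finset V).erase s with hP
  set R : Finset V := ({r | C r ≠ i} : Finset V).erase t with hR
  have hst : s ≠ t := by rintro rfl; exact ht hs
  have hsP : s ∉ P := Finset.notMem_erase _ _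
  have htR : t ∉ R := Finset.notMem_erase _ _
  have hsR : s ∉ R := by simp [hR, hs]
  have htP : t ∉ P := by simp [hP, ht]
  have hPR : Disjoint P R := by
    refine Finset.disjoint_left.2 fun v hv hv' => ?_
    simp only [hP, hR, Finset.mem_erase, Finset.mem_filter, Finset.mem_univ, true_and] at hv hv'
    exact hv'.2 hv.2
  have hAP : A ⊆ P := fun a ha => by simp [hP, hA a ha]
  have hLR : L ⊆ R := fun b hb => by
    obtain ⟨a, ha, hb⟩ := Finset.mem_biUnion.1 hb
    simp [hR, hB a ha b hb]
  have hαA : ∀ b ∈ L, α b ∈ A := fun b hb => by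
    obtain ⟨a, ha, hb⟩ := Finset.mem_biUnion.1 hb
    rwa [hα a ha b hb]
  have hAL : Disjoint A L :=
    Finset.disjoint_of_subset_left hAP (Finset.disjoint_of_subset_right hLR hPR)
  choose κ g hκ using fun z m m' => exists_star_forest_form P R A L hPR hAP hLR α hαA
    (fun p r => if G.Adj p r then 1 else 0)
    (fun a ha b hb => by
      by_cases h : a = α b
      · rw [if_neg (by rw [hadj a ha b hb]; exact not_not.2 h), if_pos h, zero_add]
      · rw [if_pos ((hadj a ha b hb).2 h), if_neg h]; rfl) z m m'
  set W : Finset V := (P \ A) ∪ (R \ L) with hW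
  have hsW : s ∉ W := by simp [hW, hsP, hsR]
  have htW : t ∉ W := by simp [hW, htP, htR]
  refine ⟨.measureZ W.toList fun z => .measure s .X fun m => .measure t .X fun m' =>
    .cliffords (fun v => zPow (g z m m' v)) (fun v => isClifford_zPow _) (A ∪ L).toList
      (.cliffords (fun _ => hadamard) (fun _ => isClifford_hadamard) L.toList .done), ?_⟩
  refine Protocol.ensures_measureZ _ _ W.nodup_toList _ _ fun z m _ m' _ => ?_
  rw [Protocol.ensures_cliffords, Protocol.ensures_cliffords]
  set c : ℂ := (((Real.sqrt 2 : ℝ) : ℂ)⁻¹) ^ Fintype.card V with hc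
  let I : State V := fun x => ∏ v ∈ W, if x v = z v then 1 else 0
  let q : (V → Fin 2) → Fin 2 := fun x =>
    ∑ p ∈ P, ∑ r ∈ R, (if G.Adj p r then 1 else 0) * (x p * x r)
  have hI : ∀ x y, (∀ v ∈ W, x v = y v) → I x = I y := fun x y h =>
    Finset.prod_congr rfl fun v hv => by rw [h v hv]
  have hIu : ∀ u ∉ W, ∀ x b, I (Function.update x u b) = I x := fun u hu x b =>
    hI _ _ fun v hv => Function.update_of_ne (ne_of_mem_of_not_mem hv hu) _ _
  have hsum : ∀ (S : Finset V), ∀ u ∉ S, ∀ (x : V → Fin 2) b,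
      ∑ v ∈ S, Function.update x u b v = ∑ v ∈ S, x v := fun S u hu x b =>
    Finset.sum_congr rfl fun v hv => Function.update_of_ne (ne_of_mem_of_not_mem hv hu) _ _
  have hqu : ∀ u, u ∉ P → u ∉ R → ∀ x b, q (Function.update x u b) = q x :=
    fun u hu hu' x b => Finset.sum_congr rfl fun p hp => Finset.sum_congr rfl fun r hr => by
      rw [Function.update_of_ne (ne_of_mem_of_not_mem hp hu),
        Function.update_of_ne (ne_of_mem_of_not_mem hr hu')]
  -- The state after the `Z` measurements, arranged for the `X` measurement of `s`.
  have s1 : (fun x : V → Fin 2 =>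
        (W.toList.map fun v => if x v = z v then (1 : ℂ) else 0).prod * graphState G x) =
      fun x => (c * I x * sgn (q x + x t * ∑ p ∈ P, x p)) * sgn (x s * (x t + ∑ r ∈ R, x r)) := by
    funext x
    rw [graphState_eq_of_star G C i s t hs ht hsadj htadj x, sgn_add, Finset.prod_map_toList]
    simp only [q, hc, I]
    ring
  have s2 := applyAt_proj_X_sgn s m (fun x => c * I x * sgn (q x + x t * ∑ p ∈ P, x p))
    (fun x => x t + ∑ r ∈ R, x r)
    (fun x b => by rw [hIu s hsW, hqu s hsP hsR, hsum P s hsP, Function.update_of_ne hst.symm])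
    (fun x b => by rw [hsum R s hsR, Function.update_of_ne hst.symm])
  have s3 : (fun x : V → Fin 2 => c * I x * sgn (q x + x t * ∑ p ∈ P, x p) *
        (sgn (m * x s) * if x t + ∑ r ∈ R, x r = m then 1 else 0)) =
      fun x => (c * I x * sgn (q x) * sgn (m * x s)) *
        (sgn (x t * ∑ p ∈ P, x p) * if x t + ∑ r ∈ R, x r = m then 1 else 0) := by
    funext x
    rw [sgn_add]
    ring
  have s4 := applyAt_proj_X_constraint t m m' (fun x => c * I x * sgn (q x) * sgn (m * x s))
    (fun x => ∑ r ∈ R, x r) (fun x => ∑ p ∈ P, x p)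
    (fun x b => by rw [hIu t htW, hqu t htP htR, Function.update_of_ne hst])
    (fun x b => by rw [hsum R t htR]) (fun x b => by rw [hsum P t htP])
  rw [s1, s2, s3, s4, applyList_zPow]
  let F : State V := fun x =>
    c * I x * sgn (m * x s) * (1 / 2 * sgn (m' * x t)) * sgn (κ z m m')
  have hF : ∀ x y, (∀ v ∉ A ∪ L, x v = y v) → F x = F y := fun x y h => by
    have hWAL : ∀ v ∈ W, v ∉ A ∪ L := by
      intro v hv hv'
      simp only [hW, Finset.mem_union, Finset.mem_sdiff] at hv hv'
      rcases hv with ⟨h1, h2⟩ | ⟨h1, h2⟩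
      · exact Finset.disjoint_left.1 hPR h1 (hLR (hv'.resolve_left h2))
      · exact Finset.disjoint_left.1 hPR (hAP (hv'.resolve_right h2)) h1
    have hs' : s ∉ A ∪ L := fun h => (Finset.mem_union.1 h).elim (fun h => hsP (hAP h))
      fun h => hsR (hLR h)
    have ht' : t ∉ A ∪ L := fun h => (Finset.mem_union.1 h).elim (fun h => htP (hAP h))
      fun h => htR (hLR h)
    simp only [F, hI x y fun v hv => h v (hWAL v hv), h s hs', h t ht']
  -- The `Z` corrections cancel the linear part of the exponent.
  have s5 : (fun x : V → Fin 2 => ((A ∪ L).toList.map fun v => sgn (g z m m' v * x v)).prod *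
        (c * I x * sgn (q x) * sgn (m * x s) *
          (1 / 2 * sgn (m' * x t) * sgn ((m + ∑ r ∈ R, x r) * (m' + ∑ p ∈ P, x p))))) =
      fun x => F x * (L.toList.map fun b => sgn (x b * x (α b))).prod := by
    funext x
    rw [Finset.prod_map_toList, Finset.prod_map_toList, ← sgn_sum, ← sgn_sum]
    by_cases hx : ∀ v ∈ W, x v = z v
    · have h := hκ z m m' x (fun v hv => hx v (Finset.mem_union_left _ hv))
        (fun v hv => hx v (Finset.mem_union_right _ hv))
      have h' := congrArg sgn h
      rw [sgn_add, sgn_add, sgn_add] at h'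
      have hsq := sgn_mul_self (∑ v ∈ A ∪ L, g z m m' v * x v)
      simp only [F, q]
      linear_combination (sgn (∑ v ∈ A ∪ L, g z m m' v * x v) * c * I x * sgn (m * x s) *
        (1 / 2) * sgn (m' * x t)) * h' + (c * I x * sgn (m * x s) * (1 / 2) * sgn (m' * x t) *
        sgn (κ z m m') * sgn (∑ b ∈ L, x b * x (α b))) * hsq
    · have hI0 : I x = 0 := by
        simp only [not_forall] at hx
        obtain ⟨v, hv, hne⟩ := hx
        exact Finset.prod_eq_zero hv (if_neg hne)
      simp [F, hI0]
  rw [s5, applyList_hadamard α _ L.nodup_toList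
    (fun b hb => by
      rw [Finset.mem_toList] at hb ⊢
      exact Finset.disjoint_left.1 hAL (hαA b hb)) F
    (fun v hv x b => hF _ _ fun u hu => Function.update_of_ne
      (ne_of_mem_of_not_mem (Finset.mem_union_right A (Finset.mem_toList.1 hv)) hu).symm _ _)]
  refine isGHZProduct_of_leaves A B α hα F hF z ?_ _ fun x => by rw [Finset.prod_map_toList]
  have hI1 : I z = 1 := Finset.prod_eq_one fun _ _ => if_pos rfl
  simp only [F, hI1, mul_one]
  refine mul_ne_zero (mul_ne_zero (mul_ne_zero ?_ (sgn_ne_zero _))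
    (mul_ne_zero (by norm_num) (sgn_ne_zero _))) (sgn_ne_zero _)
  exact pow_ne_zero _ (inv_ne_zero sqrt_two_ne_zero)

lemma mem_starVertices_iff (C : G.Coloring (Fin 2)) (i : Fin 2) (v : V) :
    v ∈ starVertices G C i ↔ C v = i ∧ ∀ w, G.Adj v w ↔ C w ≠ i := by
  simp [starVertices, part, Finset.ext_iff]

end Extraction

end RemoteExtraction

theorem lemma1 {V : Type*} [Fintype V] [DecidableEq V] (G : SimpleGraph V) [DecidableRel G.Adj]
    (C : G.Coloring (Fin 2))
    (hstar : ∀ j : Fin 2, (RemoteExtraction.starVertices G C j).Nonempty)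
    (n : ℕ) (hn : 1 ≤ n)
    (i : Fin 2) (A : Finset V) (hA : A ⊆ RemoteExtraction.nonStarVertices G C i)
    (hcard : ∀ v ∈ A, n - 1 ≤ (RemoteExtraction.oppositeRemoteSet G C v).card)
    (hdisj : ∀ v ∈ A, ∀ w ∈ A, v ≠ w →
      Disjoint (RemoteExtraction.oppositeRemoteSet G C v)
        (RemoteExtraction.oppositeRemoteSet G C w)) :
    RemoteExtraction.RemoteGHZExtractable G A.card n := by
  -- For `a ∈ A`, the GHZ state lives on `a` together with `n - 1` of its remote vertices `B a`.
  obtain ⟨s, hs⟩ := hstar i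
  obtain ⟨j, hj⟩ : ∃ j : Fin 2, j ≠ i := exists_ne i
  obtain ⟨t, ht⟩ := hstar j
  have hsmem := hs
  rw [RemoteExtraction.mem_starVertices_iff] at hs ht
  have htadj : ∀ p, C p = i → G.Adj t p := fun p hp => (ht.2 p).2 (hp ▸ hj.symm)
  have hAi : ∀ a ∈ A, C a = i ∧ a ≠ s := fun a ha => by
    have h := hA ha
    simp only [RemoteExtraction.nonStarVertices, Finset.mem_sdiff] at h
    exact ⟨by simpa [RemoteExtraction.part] using h.1, fun e => h.2 (e ▸ hsmem)⟩
  have hB' : ∀ a, ∃ B : Finset V, a ∈ A →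
      B ⊆ RemoteExtraction.oppositeRemoteSet G C a ∧ B.card = n - 1 := fun a => by
    by_cases ha : a ∈ A
    · obtain ⟨B, hB⟩ := Finset.exists_subset_card_eq (hcard a ha)
      exact ⟨B, fun _ => hB⟩
    · exact ⟨∅, fun h => absurd h ha⟩
  choose B hB using hB'
  have hBmem : ∀ a ∈ A, ∀ b ∈ B a, C b ≠ i ∧ ¬ G.Adj a b := fun a ha b hb => by
    have h := (hB a ha).1 hb
    simpa [RemoteExtraction.oppositeRemoteSet, (hAi a ha).1] using h
  have huniq : ∀ a ∈ A, ∀ a' ∈ A, ∀ b, b ∈ RemoteExtraction.oppositeRemoteSet G C a →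
      b ∈ RemoteExtraction.oppositeRemoteSet G C a' → a = a' := fun a ha a' ha' b hb hb' => by
    by_contra hne
    exact Finset.disjoint_left.1 (hdisj a ha a' ha' hne) hb hb'
  have hα' : ∀ b, ∃ a, ∀ a' ∈ A, b ∈ B a' → a = a' := fun b => by
    by_cases h : ∃ a ∈ A, b ∈ B a
    · obtain ⟨a, ha, hb⟩ := h
      exact ⟨a, fun a' ha' hb' => huniq a ha a' ha' b ((hB a ha).1 hb) ((hB a' ha').1 hb')⟩
    · exact ⟨b, fun a' ha' hb' => absurd ⟨a', ha', hb'⟩ h⟩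
  choose α hα using hα'
  have hnotB : ∀ a ∈ A, ∀ a' ∈ A, a ∉ B a' := fun a ha a' ha' h =>
    (hBmem a' ha' a h).1 (hAi a ha).1
  refine ⟨fun k => insert (A.equivFin.symm k : V) (B (A.equivFin.symm k)), fun k => ?_,
    fun k l hkl => ?_, fun k u hu w hw huw => ?_, ?_⟩
  · have ha := (A.equivFin.symm k).2
    rw [Finset.card_insert_of_notMem (hnotB _ ha _ ha), (hB _ ha).2]
    omega
  · have ha := (A.equivFin.symm k).2
    have ha' := (A.equivFin.symm l).2
    have hne : (A.equivFin.symm k : V) ≠ A.equivFin.symm l := fun e =>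
      hkl (A.equivFin.symm.injective (Subtype.ext e))
    refine Finset.disjoint_left.2 fun v hv hv' => ?_
    rcases Finset.mem_insert.1 hv with e | h <;> rcases Finset.mem_insert.1 hv' with e' | h'
    · exact hne (e.symm.trans e')
    · exact hnotB _ ha _ ha' (e ▸ h')
    · exact hnotB _ ha' _ ha (e' ▸ h)
    · exact hne ((hα v _ ha h).symm.trans (hα v _ ha' h'))
  · have ha := (A.equivFin.symm k).2
    rcases Finset.mem_insert.1 hu with rfl | hu <;> rcases Finset.mem_insert.1 hw with rfl | hw
    · exact absurd rfl huw
    · exact (hBmem _ ha _ hw).2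
    · exact fun h => (hBmem _ ha _ hu).2 h.symm
    · intro h
      have h1 := (hBmem _ ha _ hu).1
      have h2 := (hBmem _ ha _ hw).1
      exact C.valid h (by omega)
  · refine RemoteExtraction.exists_protocol_of_star G C i s t hs.1 (ht.1 ▸ hj)
      (fun r hr => (hs.2 r).2 hr) (fun p hp => (htadj p hp).symm) A B α hAi
      (fun a ha b hb => ⟨(hBmem a ha b hb).1, ?_⟩) (fun a ha b hb => hα b a ha hb)
      (fun a ha b hb => ?_)
    · rintro rfl
      exact (hBmem a ha b hb).2 (htadj a (hAi a ha).1).symm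
    · obtain ⟨a', ha', hb⟩ := Finset.mem_biUnion.1 hb
      rw [hα b a' ha' hb]
      refine ⟨fun h e => (hBmem a' ha' b hb).2 (e ▸ h), fun hne => ?_⟩
      -- A leaf of another star is not remote from `a`, as the remote sets are disjoint.
      by_contra h
      refine hne (huniq a ha a' ha' b ?_ ((hB a' ha').1 hb))
      simp [RemoteExtraction.oppositeRemoteSet, (hAi a ha).1, (hBmem a' ha' b hb).1, h]
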